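/- Let $\mathcal{X}$ be a semi-abelian category (pointed, with binary coproducts, Barr exact and Bourn protomodular) which is arithmetical, that is, a Barr exact Mal'tsev category in which the equivalence relations on each object form a distributive lattice under inclusion. For subobjects $k\colon K\to X$ and $l\colon L\to X$, the Higgins commutator $[K,L]\leq X$ is the image of the composite $$K\diamond L \to K+L \to X,$$ where $K\diamond L$ is the kernel of the canonical morphism $K+L\to K\times L$ and $K+L\to X$ is the morphism induced by $k$ and $l$. The Huq commutator $[K,L]_X$ is the smallest normal subobject $N$ of $X$ such that the images $K'$, $L'$ of $K$ and $L$ in $X/N$ commute, i.e. such that there is a morphism $K'\times L'\to X/N$ which restricts to the inclusions of $K'$ and $L'$ along $\langle 1,0\rangle$ and $\langle 0,1\rangle$. Then $\mathcal{X}$ satisfies condition (WNH): for every object $X$ and every normal subobject $K$ of $X$, the Higgins commutator $[K,K]$ is normal in $X$. Moreover, $[K,K]_X=K$ for every normal subobject $K$ of every object $X$. -/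

import Mathlib

open CategoryTheory CategoryTheory.Limits

universe v u

namespace SemiAb

section Classes

variable (C : Type u) [Category.{v} C]

/-- A Barr exact category: a regular category in which every internal equivalence relation is
effective, i.e. is the kernel pair of its coequalizer. -/
class BarrExact : Prop extends Regular C where
  effective : ∀ {R X : C} (p₁ p₂ : R ⟶ X), IsEquivalenceRelation p₁ p₂ →
    IsEffectiveEquivalenceRelation p₁ p₂

/-- Bourn protomodularity: the change-of-base functors `f^* : Pt_Y ⟶ Pt_X` between categories of
points reflect isomorphisms. A point over `Y` is a morphism `p : A ⟶ Y` with a section `s`, and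
`h : (A, p, s) ⟶ (B, q, t)` is a morphism of points over `Y`. The two squares `hA` and `hB` are
the pullbacks of the two points along `f`, and `h'` is the morphism induced by `h`. -/
class Protomodular : Prop where
  isIso_of_changeOfBase : ∀ {X Y A B A' B' : C} (f : X ⟶ Y)
    (p : A ⟶ Y) (s : Y ⟶ A) (q : B ⟶ Y) (t : Y ⟶ B) (h : A ⟶ B)
    (a : A' ⟶ A) (p' : A' ⟶ X) (b : B' ⟶ B) (q' : B' ⟶ X) (h' : A' ⟶ B'),
    s ≫ p = 𝟙 Y → t ≫ q = 𝟙 Y → h ≫ q = p → s ≫ h = t →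
    IsPullback a p' p f → IsPullback b q' q f →
    h' ≫ b = a ≫ h → h' ≫ q' = p' →
    IsIso h' → IsIso h

/-- A semi-abelian category: pointed, with binary coproducts, Barr exact and protomodular. -/
class SemiAbelian : Prop extends BarrExact C, Protomodular C where
  hasZeroObject : HasZeroObject C
  hasBinaryCoproducts : HasBinaryCoproducts C

attribute [instance] SemiAbelian.hasZeroObject SemiAbelian.hasBinaryCoproducts

/-- The Mal'tsev property: every internal reflexive relation is an equivalence relation. -/
class Maltsev : Prop where
  isEquivalenceRelation : ∀ {R X : C} (p₁ p₂ : R ⟶ X),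
    Nonempty (ReflexiveRelation p₁ p₂) → IsEquivalenceRelation p₁ p₂

end Classes

/-- The internal equivalence relations on `X`, as subobjects of `X ⨯ X`. They are ordered by
inclusion (the order induced from `Subobject (X ⨯ X)`). -/
abbrev EqRel {C : Type u} [Category.{v} C] [HasBinaryProducts C] (X : C) : Type (max u v) :=
  {R : Subobject (X ⨯ X) //
    IsEquivalenceRelation (R.arrow ≫ (prod.fst : X ⨯ X ⟶ X)) (R.arrow ≫ (prod.snd : X ⨯ X ⟶ X))}

/-- The partially ordered set `P` is a distributive lattice. -/
def IsDistributiveLattice (P : Type*) [PartialOrder P] : Prop :=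
  ∃ D : DistribLattice P, ∀ a b : P, D.le a b ↔ a ≤ b

/-- An arithmetical category: a Barr exact Mal'tsev category in which the equivalence relations on
each object form a distributive lattice. -/
class Arithmetical (C : Type u) [Category.{v} C] : Prop extends BarrExact C, Maltsev C where
  distributive : ∀ X : C, IsDistributiveLattice (EqRel X)

section Commutators

variable {C : Type u} [Category.{v} C] [HasZeroMorphisms C]

/-- `K ◁ X`: the subobject `K` of `X` is the kernel of some morphism. -/
def IsNormal {X : C} (K : Subobject X) : Prop :=
  Nonempty (NormalMono K.arrow)

/-- Two subobjects `K`, `L` of `X` Huq-commute: there is `φ : K ⨯ L ⟶ X` which restricts to the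
inclusion of `K` along `⟨1, 0⟩` and to the inclusion of `L` along `⟨0, 1⟩`. -/
def HuqCommute [HasBinaryProducts C] {X : C} (K L : Subobject X) : Prop :=
  ∃ φ : (K : C) ⨯ (L : C) ⟶ X,
    prod.lift (𝟙 (K : C)) 0 ≫ φ = K.arrow ∧ prod.lift 0 (𝟙 (L : C)) ≫ φ = L.arrow

variable [Regular C]

/-- The images of `K` and `L` in the quotient `X / N` (the cokernel of `N`) Huq-commute. -/
def CommuteModulo {X : C} (K L N : Subobject X) : Prop :=
  ∃ (Q : C) (q : X ⟶ Q) (w : N.arrow ≫ q = 0),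
    Nonempty (IsColimit (CokernelCofork.ofπ q w)) ∧
    HuqCommute (imageSubobject (K.arrow ≫ q)) (imageSubobject (L.arrow ≫ q))

/-- `N` is the Huq commutator `[K, L]_X`: the smallest normal subobject of `X` such that the images
of `K` and `L` in `X / N` commute. -/
def IsHuqCommutator {X : C} (K L N : Subobject X) : Prop :=
  IsLeast {M : Subobject X | IsNormal M ∧ CommuteModulo K L M} N

variable [HasBinaryCoproducts C]

/-- The canonical comparison `K + L ⟶ K × L`, with matrix the identity matrix. -/
noncomputable def sumToProd (K L : C) : K ⨿ L ⟶ K ⨯ L :=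
  coprod.desc (prod.lift (𝟙 K) 0) (prod.lift 0 (𝟙 L))

/-- The co-smash product `K ⋄ L`, the kernel of `K + L ⟶ K × L`. -/
noncomputable def cosmash (K L : C) : C := kernel (sumToProd K L)

/-- The inclusion `K ⋄ L ⟶ K + L`. -/
noncomputable def cosmashι (K L : C) : cosmash K L ⟶ K ⨿ L := kernel.ι (sumToProd K L)

/-- The Higgins commutator `[K, L]`: the image of `K ⋄ L ⟶ K + L ⟶ X`. -/
noncomputable def higginsCommutator {X : C} (K L : Subobject X) : Subobject X :=
  imageSubobject (cosmashι (K : C) (L : C) ≫ coprod.desc K.arrow L.arrow)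

variable (C) in
/-- Condition (WNH): for every normal subobject `K` of an object `X`, the Higgins commutator
`[K, K]` is normal in `X`. -/
def WNH : Prop :=
  ∀ (X : C) (K : Subobject X), IsNormal K → IsNormal (higginsCommutator K K)

end Commutators

end SemiAb

/-!
An arithmetical semi-abelian category has no non-trivial abelian objects, and both commutators of
`K` with itself then collapse to `K`.

The key lemma is `eq_zero_of_self_cooperates`: if `q : K ⟶ Q` admits `φ : K ⨯ K ⟶ Q` restricting to
`q` along both `⟨1, 0⟩` and `⟨0, 1⟩`, then `q = 0`. On `K ⨯ K` consider the kernel pairs `Eq(π₁)`,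
`Eq(π₂)` and `Eq(φ)`. The join of the last two is the total relation, since a morphism that factors
through `π₂` and is compatible with `φ` is zero. On the other hand the meets `Eq(π₁) ∧ Eq(π₂)` and
`Eq(π₁) ∧ Eq(φ)` lie in `Eq(q × q)`; for the second one, the kernel of `⟨π₁, φ⟩` consists of
the pairs `(0, y)` with `q y = 0`, and in a protomodular category a kernel pair is controlled by the
kernel (`comp_eq_of_kernel_comp_eq_zero`). Distributivity gives `Eq(π₁) ≤ Eq(q × q)`, that
is, `q = 0`.

For the Huq commutator, if the image of `K` in `X / N` commutes with itself, then it is zero by the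
key lemma, so `K ≤ N`; and `K` itself has trivial image in `X / K`.

For the Higgins commutator, the image of `K ⋄ K` under the fold map `K + K ⟶ K` is the kernel of some
`q : K ⟶ Q`, since direct images of kernels along regular epimorphisms are kernels in an exact
Mal'tsev protomodular category (`exists_kernel_image`). As `K + K ⟶ K ⨯ K` is the cokernel of
`K ⋄ K ⟶ K + K` (`strongEpi_sumToProd`, `exists_fac_of_isRegularEpi`), the fold map followed by `q`
factors through some `φ` as in the key lemma. Hence `q = 0`, the morphism `K ⋄ K ⟶ K` is a strong
epimorphism, and `[K, K] = K`.
-/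

namespace SemiAb

attribute [local simp] prod.lift_fst prod.lift_snd prod.lift_fst_assoc prod.lift_snd_assoc
  pullback.lift_fst pullback.lift_snd pullback.lift_fst_assoc pullback.lift_snd_assoc

/-! ### Protomodularity and kernels -/

section Protomodular

open scoped ZeroObject

variable {C : Type u} [Category.{v} C] [HasZeroMorphisms C] [HasZeroObject C]

lemma isPullback_kernel_zero {K A Y : C} (k : K ⟶ A) [Mono k] (p : A ⟶ Y) (w : k ≫ p = 0)
    (hk : ∀ {W : C} (x : W ⟶ A), x ≫ p = 0 → ∃ l, l ≫ k = x) :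
    IsPullback k (0 : K ⟶ 0) p (0 : 0 ⟶ Y) := by
  refine ⟨⟨by simp [w]⟩, ⟨PullbackCone.IsLimit.mk _
    (fun t => (hk t.fst (by simpa using t.condition)).choose)
    (fun t => (hk t.fst (by simpa using t.condition)).choose_spec) (fun t => ?_)
    (fun t l h₁ _ => ?_)⟩⟩
  · exact (isZero_zero C).eq_of_tgt _ _
  · rw [← cancel_mono k, h₁]
    exact (hk t.fst (by simpa using t.condition)).choose_spec.symm

section Regular

variable [Regular C] [Protomodular C]

/-- For a split epimorphism `p` with section `s`, the morphisms `s` and `ker p` are jointly strongly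
epic: a subobject containing both is everything. This is protomodularity for the change of base
along `0 ⟶ Y`. -/
lemma isIso_of_section_of_kernel {A Y S : C} (p : A ⟶ Y) (s : Y ⟶ A) (hs : s ≫ p = 𝟙 Y)
    (m : S ⟶ A) [Mono m] (s' : Y ⟶ S) (hs' : s' ≫ m = s)
    (k' : kernel p ⟶ S) (hk' : k' ≫ m = kernel.ι p) : IsIso m := by
  have hk : Mono k' := mono_of_mono_fac hk'
  refine Protomodular.isIso_of_changeOfBase (0 : 0 ⟶ Y) (m ≫ p) s' p s m k' 0
    (kernel.ι p) 0 (𝟙 _) (by simp [reassoc_of% hs', hs]) hs rfl hs' ?_ ?_ (by simp [hk'])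
    (by simp) inferInstance
  · refine isPullback_kernel_zero _ _ (by simp [reassoc_of% hk']) fun x hx =>
      ⟨kernel.lift p (x ≫ m) (by simpa using hx), ?_⟩
    rw [← cancel_mono m]
    simp [hk']
  · exact isPullback_kernel_zero _ _ (by simp) fun x hx => ⟨kernel.lift p x hx, by simp⟩

/-- A morphism which vanishes on the kernel of `f` coequalizes the kernel pair of `f`: the two
composites on the kernel pair agree on the diagonal and on the kernel of the first projection. -/
lemma comp_eq_of_kernel_comp_eq_zero {A B Z : C} (f : A ⟶ B) (g : A ⟶ Z)
    (h : kernel.ι f ≫ g = 0) {W : C} (x y : W ⟶ A) (hxy : x ≫ f = y ≫ f) : x ≫ g = y ≫ g := by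
  let m := equalizer.ι (pullback.fst f f ≫ g) (pullback.snd f f ≫ g)
  have hsnd : (kernel.ι (pullback.fst f f) ≫ pullback.snd f f) ≫ f = 0 := by
    simp [← pullback.condition]
  have : IsIso m := by
    refine isIso_of_section_of_kernel (pullback.fst f f) (pullback.diagonal f) (by simp) m
      (equalizer.lift (pullback.diagonal f) (by simp)) (equalizer.lift_ι _ _)
      (equalizer.lift (kernel.ι _) ?_) (equalizer.lift_ι _ _)
    rw [kernel.condition_assoc, zero_comp, ← Category.assoc, ← kernel.lift_ι f _ hsnd,
      Category.assoc, h, comp_zero]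
  have e : pullback.fst f f ≫ g = pullback.snd f f ≫ g := by
    rw [← cancel_epi m]
    exact equalizer.condition _ _
  simpa using pullback.lift x y hxy ≫= e

/-- A regular epimorphism is a cokernel of its kernel. -/
lemma exists_fac_of_isRegularEpi {A B Z : C} (f : A ⟶ B) [IsRegularEpi f] (g : A ⟶ Z)
    (h : kernel.ι f ≫ g = 0) : ∃ l : B ⟶ Z, f ≫ l = g :=
  ⟨IsRegularEpi.desc f g (comp_eq_of_kernel_comp_eq_zero f g h _ _ (IsRegularEpi.w f)),
    IsRegularEpi.fac f g _⟩

/-- The short five lemma for regular epimorphisms `m ≫ p`, where `m` is a monomorphism: pulling `p`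
back along `m ≫ p` gives a split epimorphism, whose section and kernel both lie in the
pullback of `m`. -/
lemma isIso_of_strongEpi_of_kernel {I P Y : C} (m : I ⟶ P) [Mono m] (p : P ⟶ Y)
    [StrongEpi (m ≫ p)] (k' : kernel p ⟶ I) (hk' : k' ≫ m = kernel.ι p) : IsIso m := by
  let t₁ := pullback.fst (m ≫ p) p
  let t₂ := pullback.snd (m ≫ p) p
  let n := pullback.fst t₂ m
  have hκ : (kernel.ι t₁ ≫ t₂) ≫ p = 0 := by
    simp [t₁, t₂, ← pullback.condition]
  have : IsIso n := by
    refine isIso_of_section_of_kernel t₁ (pullback.lift (𝟙 I) m (by simp)) (by simp [t₁]) n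
      (pullback.lift (pullback.lift (𝟙 I) m (by simp)) (𝟙 I) (by simp [t₂])) (by simp [n])
      (pullback.lift (kernel.ι t₁) (kernel.lift p _ hκ ≫ k') (by simp [hk'])) (by simp [n])
  -- `n` is invertible, so the pullback `t₂` of the regular epimorphism `m ≫ p` factors through `m`
  have hreg : IsRegularEpi (m ≫ p) := inferInstance
  have h₂ : StrongEpi (n ≫ t₂) := inferInstance
  rw [pullback.condition] at h₂
  have := strongEpi_of_strongEpi (pullback.snd t₂ m) m
  exact isIso_of_mono_of_strongEpi m

lemma strongEpi_of_kernel {I P Y : C} (h : I ⟶ P) (p : P ⟶ Y)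
    [StrongEpi (h ≫ p)] (k' : kernel p ⟶ I) (hk' : k' ≫ h = kernel.ι p) : StrongEpi h := by
  let F := Regular.strongEpiMonoFactorisation h
  have hF : F.e ≫ F.m = h := F.fac
  have : StrongEpi (F.e ≫ F.m ≫ p) := by rw [reassoc_of% hF]; infer_instance
  have := strongEpi_of_strongEpi F.e (F.m ≫ p)
  have := isIso_of_strongEpi_of_kernel F.m p (k' ≫ F.e) (by simp [hF, hk'])
  rw [← hF]
  exact strongEpi_comp _ _

/-- The image of `K + L ⟶ K ⨯ L` contains both the kernel `⟨1, 0⟩` of the second projection and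
its section `⟨0, 1⟩`. -/
lemma strongEpi_sumToProd [HasBinaryCoproducts C] (K L : C) : StrongEpi (sumToProd K L) := by
  have hl : coprod.inl ≫ sumToProd K L = prod.lift (𝟙 K) 0 := coprod.inl_desc _ _
  have hr : coprod.inr ≫ sumToProd K L = prod.lift 0 (𝟙 L) := coprod.inr_desc _ _
  have : IsSplitEpi (sumToProd K L ≫ prod.snd) :=
    ⟨⟨coprod.inr, by rw [reassoc_of% hr, prod.lift_snd]⟩⟩
  refine strongEpi_of_kernel (sumToProd K L) prod.snd (kernel.ι _ ≫ prod.fst ≫ coprod.inl) ?_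
  simp only [Category.assoc, hl]
  ext <;> simp

end Regular

/-- The direct image of a kernel along a strong epimorphism `f` is again a kernel, namely that of `q`:
a generalized element `x` of `B` killed by `q` lifts, locally for the regular topology, to an
element of `kernel g`. Here `q` is the quotient by the direct image along `f` of the kernel pair
of `g`. -/
lemma exists_kernel_image [BarrExact C] [Maltsev C] [Protomodular C] {A B Z : C}
    (g : A ⟶ Z) (f : A ⟶ B) [StrongEpi f] : ∃ (Q : C) (q : B ⟶ Q), kernel.ι g ≫ f ≫ q = 0 ∧
      ∀ {W : C} (x : W ⟶ B), x ≫ q = 0 →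
        ∃ (W' : C) (w : W' ⟶ W) (y : W' ⟶ kernel g), StrongEpi w ∧ w ≫ x = y ≫ kernel.ι g ≫ f := by
  let r₁ := pullback.fst g g
  let r₂ := pullback.snd g g
  let F := Regular.strongEpiMonoFactorisation (prod.lift (r₁ ≫ f) (r₂ ≫ f))
  have hF : F.e ≫ F.m = prod.lift (r₁ ≫ f) (r₂ ≫ f) := F.fac
  have hF₁ : F.e ≫ F.m ≫ prod.fst = r₁ ≫ f := by rw [reassoc_of% hF]; simp
  have hF₂ : F.e ≫ F.m ≫ prod.snd = r₂ ≫ f := by rw [reassoc_of% hF]; simp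
  have sq : CommSq (pullback.diagonal g ≫ F.e) f F.m (prod.lift (𝟙 B) (𝟙 B)) := ⟨by
    rw [Category.assoc, hF]
    ext <;> simp [r₁, r₂]⟩
  have hl : sq.lift ≫ F.m = prod.lift (𝟙 B) (𝟙 B) := sq.fac_right
  have hl' : f ≫ sq.lift = pullback.diagonal g ≫ F.e := sq.fac_left
  -- the image relation is reflexive, hence an equivalence relation
  have hE := Maltsev.isEquivalenceRelation (F.m ≫ prod.fst) (F.m ≫ prod.snd)
    ⟨{ right_cancellation := fun Y a b h₁ h₂ => by
        rw [← cancel_mono F.m]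
        ext <;> simpa
       r := sq.lift
       reflexivity₁ := by simp [reassoc_of% hl]
       reflexivity₂ := by simp [reassoc_of% hl] }⟩
  obtain ⟨⟨E⟩⟩ := BarrExact.effective _ _ hE
  have hP := E.isKernelPair
  refine ⟨E.B, E.π, ?_, fun {W} x hx => ?_⟩
  · have e : (F.e ≫ F.m ≫ prod.fst) ≫ E.π = (F.e ≫ F.m ≫ prod.snd) ≫ E.π := by
      have := F.e ≫= hP.w
      simpa using this
    rw [hF₁, hF₂] at e
    have := pullback.lift 0 (kernel.ι g) (by simp) ≫= e
    simpa [r₁, r₂] using this.symm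
  · -- The comparison from `Eq(g)` to the pullback of `f` along the first leg of its image is a
    -- strong epimorphism: the image contains the diagonal, hence all `(0, a)` with `f a = 0`.
    let h : pullback g g ⟶ pullback (F.m ≫ prod.fst) f := pullback.lift F.e r₁ hF₁
    have hh : StrongEpi h := by
      have : StrongEpi (h ≫ pullback.fst (F.m ≫ prod.fst) f) := by
        simp only [h, pullback.lift_fst]; infer_instance
      have hz : (kernel.ι (pullback.fst (F.m ≫ prod.fst) f) ≫
          pullback.snd (F.m ≫ prod.fst) f) ≫ f = 0 := by
        rw [Category.assoc, ← pullback.condition, kernel.condition_assoc, zero_comp]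
      refine strongEpi_of_kernel h (pullback.fst _ f)
        (kernel.ι _ ≫ pullback.snd _ f ≫ pullback.diagonal g) ?_
      ext1
      · have hz' := hz =≫ sq.lift
        rw [Category.assoc, hl', zero_comp] at hz'
        simpa [h] using hz'
      · simp [h, r₁]
    have hreg : IsRegularEpi h := inferInstance
    -- `x` corresponds to the element `(0, x)` of the image relation, and `z` to `((0, x), 0)`; its
    -- lift along `h` is a pair `(0, a)` with `g a = 0` and `f a = x`
    let x' := hP.lift 0 x (by simp [hx])
    have hx'₁ : x' ≫ F.m ≫ prod.fst = 0 := hP.lift_fst _ _ _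
    have hx'₂ : x' ≫ F.m ≫ prod.snd = x := hP.lift_snd _ _ _
    let z : W ⟶ pullback (F.m ≫ prod.fst) f := pullback.lift x' 0 (by simp [hx'₁])
    have c : pullback.fst z h ≫ z = pullback.snd z h ≫ h := pullback.condition
    have c₁ : pullback.fst z h ≫ x' = pullback.snd z h ≫ F.e := by
      simpa [z, h] using c =≫ pullback.fst _ _
    have c₂ : 0 = pullback.snd z h ≫ r₁ := by
      simpa [z, h] using c =≫ pullback.snd _ _
    refine ⟨pullback z h, pullback.fst z h, kernel.lift g (pullback.snd z h ≫ r₂) ?_,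
      inferInstance, ?_⟩
    · have : r₁ ≫ g = r₂ ≫ g := pullback.condition
      rw [Category.assoc, ← this, ← Category.assoc, ← c₂, zero_comp]
    · have e := c₁ =≫ (F.m ≫ prod.snd)
      rw [Category.assoc, Category.assoc, hx'₂, hF₂] at e
      simpa using e

end Protomodular

/-! ### Distributivity of equivalence relations -/

section Arithmetical

variable {C : Type u} [Category.{v} C]

/-- The kernel pair of `f : X ⟶ Y` as an internal equivalence relation on `X`, encoded as the
subobject of `X ⨯ X` equalizing `π₁ ≫ f` and `π₂ ≫ f`. -/
noncomputable def kernelPairRel [Regular C] {X Y : C} (f : X ⟶ Y) : EqRel X :=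
  ⟨equalizerSubobject (prod.fst ≫ f) (prod.snd ≫ f), by
    set E := equalizerSubobject ((prod.fst : X ⨯ X ⟶ X) ≫ f) (prod.snd ≫ f)
    have hw : (E.arrow ≫ prod.fst) ≫ f = (E.arrow ≫ prod.snd) ≫ f := by
      simpa only [Category.assoc] using
        equalizerSubobject_arrow_comp ((prod.fst : X ⨯ X ⟶ X) ≫ f) (prod.snd ≫ f)
    have hP : IsKernelPair f (E.arrow ≫ prod.fst) (E.arrow ≫ prod.snd) := by
      have fac (t : PullbackCone f f) : E.Factors (prod.lift t.fst t.snd) :=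
        equalizerSubobject_factors _ _ _ (by simp [t.condition])
      refine ⟨⟨hw⟩, ⟨PullbackCone.IsLimit.mk _ (fun t => E.factorThru _ (fac t))
        (fun t => by simp) (fun t => by simp) (fun t l h₁ h₂ => ?_)⟩⟩
      rw [← cancel_mono E.arrow]
      ext
      · simpa using h₁
      · simpa using h₂
    exact (IsKernelPair.equivalenceRelation f _ _
      (pullback.isLimit (E.arrow ≫ prod.snd) (E.arrow ≫ prod.fst)) hP).isEquivalenceRelation⟩

lemma le_kernelPairRel_iff [Regular C] {X Y : C} (f : X ⟶ Y) (R : EqRel X) :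
    R ≤ kernelPairRel f ↔ (R.1.arrow ≫ prod.fst) ≫ f = (R.1.arrow ≫ prod.snd) ≫ f := by
  rw [Category.assoc, Category.assoc, ← equalizerSubobject_factors_iff]
  exact ⟨fun h => Subobject.factors_of_le _ h (Subobject.factors_self _),
    fun h => Subobject.le_of_comm (Subobject.factorThru _ _ h) (Subobject.factorThru_arrow _ _ h)⟩

lemma kernelPairRel_le_iff [Regular C] {X Y Z : C} (f : X ⟶ Y) (g : X ⟶ Z) :
    kernelPairRel f ≤ kernelPairRel g ↔
      ∀ {W : C} (x y : W ⟶ X), x ≫ f = y ≫ f → x ≫ g = y ≫ g := by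
  refine ⟨fun h W x y hxy => ?_, fun h => ?_⟩
  · have hF : (kernelPairRel g).1.Factors (prod.lift x y) :=
      Subobject.factors_of_le _ h (equalizerSubobject_factors _ _ _ (by simpa))
    simpa using (equalizerSubobject_factors_iff _ _ _).1 hF
  · exact (le_kernelPairRel_iff _ _).2 (h _ _ ((le_kernelPairRel_iff _ _).1 le_rfl))

lemma exists_eq_kernelPairRel [BarrExact C] {X : C} (R : EqRel X) :
    ∃ (Q : C) (q : X ⟶ Q), R = kernelPairRel q := by
  obtain ⟨⟨E⟩⟩ := BarrExact.effective _ _ R.2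
  have hP := E.isKernelPair
  have hw := (le_kernelPairRel_iff E.π _).1 le_rfl
  refine ⟨E.B, E.π, le_antisymm ((le_kernelPairRel_iff _ _).2 hP.w) ?_⟩
  refine Subobject.le_of_comm (hP.lift _ _ hw) ?_
  ext
  · simp
  · simp

/-- The consequence of distributivity used below, phrased by universal properties: if
`a ⊓ b ≤ e`, `a ⊓ c ≤ e` and `a ≤ b ⊔ c`, then `a ≤ e`. -/
lemma IsDistributiveLattice.le_of_forall_le {P : Type*} [PartialOrder P]
    (hP : IsDistributiveLattice P) {a b c e : P} (hb : ∀ x, x ≤ a → x ≤ b → x ≤ e)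
    (hc : ∀ x, x ≤ a → x ≤ c → x ≤ e) (ha : ∀ u, b ≤ u → c ≤ u → a ≤ u) : a ≤ e := by
  obtain ⟨D, hD⟩ := hP
  simp only [← hD] at hb hc ha ⊢
  have h₁ : D.le a (D.inf a (D.sup b c)) :=
    D.le_inf _ _ _ (D.le_refl a) (ha _ (D.le_sup_left _ _) (D.le_sup_right _ _))
  have h₂ : D.le (D.inf a (D.sup b c)) (D.sup (D.inf a b) (D.inf a c)) :=
    @Eq.le P D.toPreorder _ _ (@inf_sup_left P D a b c)
  exact D.le_trans _ _ _ h₁ (D.le_trans _ _ _ h₂ (D.sup_le _ _ _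
    (hb _ (D.inf_le_left _ _) (D.inf_le_right _ _))
    (hc _ (D.inf_le_left _ _) (D.inf_le_right _ _))))

variable [HasZeroMorphisms C] [HasZeroObject C] [Arithmetical C] [Protomodular C]

/-- A morphism which commutes with itself is zero. For `q = 𝟙 K` this says that abelian objects
are trivial. -/
lemma eq_zero_of_self_cooperates {K Q : C} (q : K ⟶ Q) (φ : K ⨯ K ⟶ Q)
    (h₁ : prod.lift (𝟙 K) 0 ≫ φ = q) (h₂ : prod.lift 0 (𝟙 K) ≫ φ = q) : q = 0 := by
  have hle : kernelPairRel (prod.fst : K ⨯ K ⟶ K) ≤ kernelPairRel (prod.map q q) := by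
    refine (Arithmetical.distributive (K ⨯ K)).le_of_forall_le
      (b := kernelPairRel prod.snd) (c := kernelPairRel φ) (fun R ha hb => ?_)
      (fun R ha hc => ?_) (fun R hb hc => ?_)
    · rw [le_kernelPairRel_iff] at ha hb ⊢
      rw [prod.hom_ext ha hb]
    · rw [le_kernelPairRel_iff] at ha hc ⊢
      refine comp_eq_of_kernel_comp_eq_zero (prod.lift prod.fst φ) _ ?_ _ _ ?_
      · set k := kernel.ι (prod.lift prod.fst φ)
        have hk₁ : k ≫ prod.fst = 0 := by
          simpa using kernel.condition (prod.lift prod.fst φ) =≫ prod.fst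
        have hk₂ : k ≫ φ = 0 := by
          simpa using kernel.condition (prod.lift prod.fst φ) =≫ prod.snd
        -- the kernel of `⟨π₁, φ⟩` lies in `0 ⨯ K`, where `φ` restricts to `q`
        have hk₃ : k = (k ≫ prod.snd) ≫ prod.lift 0 (𝟙 K) := by
          ext <;> simp [hk₁]
        have hk₄ : (k ≫ prod.snd) ≫ q = 0 := by
          rw [← h₂, ← Category.assoc, ← hk₃, hk₂]
        ext
        · simp [reassoc_of% hk₁]
        · simpa using hk₄
      · ext
        · simpa using ha
        · simpa using hc
    · obtain ⟨Z, r, rfl⟩ := exists_eq_kernelPairRel R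
      rw [kernelPairRel_le_iff] at hb hc
      -- `r` is compatible with `π₂` and with `φ`: `r (x, 0) = 0`, and `r (0, y) = r (y, 0)`
      -- because `φ (0, y) = φ (y, 0)`
      have hl : prod.lift (𝟙 K) 0 ≫ r = 0 := by
        simpa using hb (prod.lift (𝟙 K) 0) 0 (by simp)
      have hr : prod.lift 0 (𝟙 K) ≫ r = 0 := by
        rw [hc _ (prod.lift (𝟙 K) 0) (h₂.trans h₁.symm), hl]
      have h₀ : r = 0 := by
        have := hb (𝟙 _) (prod.snd ≫ prod.lift 0 (𝟙 K)) (by simp)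
        rwa [Category.assoc, hr, comp_zero, Category.id_comp] at this
      exact (kernelPairRel_le_iff _ _).2 fun x y _ => by simp [h₀]
  -- `(0, y)` and `(0, 0)` have the same first projection
  have h := (kernelPairRel_le_iff _ _).1 hle (prod.lift 0 (𝟙 K)) 0 (by simp) =≫ prod.snd
  simpa using h

end Arithmetical

/-! ### The commutators of a subobject with itself -/

section Commutators

variable {C : Type u} [Category.{v} C] [HasZeroMorphisms C] [SemiAbelian C] [Arithmetical C]

lemma strongEpi_cosmashι_fold (K : C) :
    StrongEpi (cosmashι K K ≫ coprod.desc (𝟙 K) (𝟙 K)) := by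
  have : IsSplitEpi (coprod.desc (𝟙 K) (𝟙 K)) := ⟨⟨coprod.inl, coprod.inl_desc _ _⟩⟩
  obtain ⟨Q, q, hq, hx⟩ := exists_kernel_image (sumToProd K K) (coprod.desc (𝟙 K) (𝟙 K))
  have := strongEpi_sumToProd K K
  have hreg : IsRegularEpi (sumToProd K K) := inferInstance
  obtain ⟨φ, hφ⟩ := exists_fac_of_isRegularEpi (sumToProd K K) _ hq
  have h₀ : q = 0 := by
    refine eq_zero_of_self_cooperates q φ ?_ ?_
    · have := coprod.inl ≫= hφ
      rwa [sumToProd, coprod.inl_desc_assoc, coprod.inl_desc_assoc, Category.id_comp] at this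
    · have := coprod.inr ≫= hφ
      rwa [sumToProd, coprod.inr_desc_assoc, coprod.inr_desc_assoc, Category.id_comp] at this
  -- the identity of `K` is killed by `q = 0`, so it is locally in the image of `K ⋄ K`
  obtain ⟨W, w, y, hw, e⟩ := hx (𝟙 K) (by simp [h₀])
  have : StrongEpi (y ≫ cosmashι K K ≫ coprod.desc (𝟙 K) (𝟙 K)) := by
    rw [Category.comp_id] at e
    exact e ▸ hw
  exact @strongEpi_of_strongEpi _ _ _ _ _ y _ this

lemma higginsCommutator_self {X : C} (K : Subobject X) : higginsCommutator K K = K := by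
  have hfold := strongEpi_cosmashι_fold (K : C)
  have e : cosmashι (K : C) (K : C) ≫ coprod.desc K.arrow K.arrow =
      (cosmashι (K : C) (K : C) ≫ coprod.desc (𝟙 _) (𝟙 _)) ≫ K.arrow := by
    rw [Category.assoc]
    congr 1
    ext <;> simp
  refine le_antisymm ?_ ?_
  · exact imageSubobject_le _ (cosmashι (K : C) (K : C) ≫ coprod.desc (𝟙 _) (𝟙 _)) e.symm
  · rw [higginsCommutator]
    have sq : CommSq
        (factorThruImageSubobject (cosmashι (K : C) (K : C) ≫ coprod.desc K.arrow K.arrow))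
        (cosmashι (K : C) (K : C) ≫ coprod.desc (𝟙 _) (𝟙 _))
        (imageSubobject (cosmashι (K : C) (K : C) ≫ coprod.desc K.arrow K.arrow)).arrow K.arrow :=
      ⟨(imageSubobject_arrow_comp _).trans e⟩
    have : sq.HasLift := (hfold.llp _).sq_hasLift sq
    exact Subobject.le_of_comm sq.lift sq.fac_right

/-- A normal subobject `K`, the kernel of `g`, has a cokernel: the regular epimorphic part of `g`. -/
lemma exists_cokernel_of_isNormal {X : C} {K : Subobject X} (hK : IsNormal K) :
    ∃ (Q : C) (q : X ⟶ Q) (w : K.arrow ≫ q = 0),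
      Nonempty (IsColimit (CokernelCofork.ofπ q w)) := by
  obtain ⟨N⟩ := hK
  let F := Regular.strongEpiMonoFactorisation N.g
  have hF : F.e ≫ F.m = N.g := F.fac
  have w : K.arrow ≫ F.e = 0 := by
    rw [← cancel_mono F.m, Category.assoc, hF, N.w, zero_comp]
  have hk : kernel.ι F.e ≫ N.g = 0 := (kernel.ι F.e ≫= hF.symm).trans <| by
    rw [kernel.condition_assoc, zero_comp]
  have fac {Z : C} (g : X ⟶ Z) (hg : K.arrow ≫ g = 0) : ∃ l, F.e ≫ l = g := by
    have : IsRegularEpi F.e := inferInstance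
    refine exists_fac_of_isRegularEpi F.e g ?_
    obtain ⟨l, hl⟩ := NormalMono.lift' K.arrow (kernel.ι F.e) hk
    rw [← hl, Category.assoc, hg, comp_zero]
  exact ⟨F.I, F.e, w, ⟨CokernelCofork.IsColimit.ofπ F.e w (fun g hg => (fac g hg).choose)
    (fun g hg => (fac g hg).choose_spec)
    (fun g hg l hl => by rw [← cancel_epi F.e, hl, (fac g hg).choose_spec])⟩⟩

lemma isHuqCommutator_self {X : C} {K : Subobject X} (hK : IsNormal K) :
    IsHuqCommutator K K K := by
  refine ⟨⟨hK, ?_⟩, fun M ⟨⟨N⟩, Q, q, w, ⟨hq⟩, φ, h₁, h₂⟩ => ?_⟩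
  · obtain ⟨Q, q, w, hq⟩ := exists_cokernel_of_isNormal hK
    refine ⟨Q, q, w, hq, 0, ?_⟩
    have : (imageSubobject (K.arrow ≫ q)).arrow = 0 := by
      rw [w, imageSubobject_zero_arrow]
    simp [this]
  · have h₀ := eq_zero_of_self_cooperates _ φ h₁ h₂
    have hKq : K.arrow ≫ q = 0 := by
      rw [← imageSubobject_arrow_comp (K.arrow ≫ q), h₀, comp_zero]
    obtain ⟨l, hl⟩ := CokernelCofork.IsColimit.desc' hq N.g N.w
    have hKg : K.arrow ≫ N.g = 0 := by
      rw [← hl]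
      exact (Category.assoc _ _ _).symm.trans ((hKq =≫ l).trans zero_comp)
    obtain ⟨t, ht⟩ := NormalMono.lift' M.arrow K.arrow hKg
    exact Subobject.le_of_comm t ht

end Commutators

end SemiAb

theorem mainTheorem9 (C : Type u) [Category.{v} C] [HasZeroMorphisms C]
    [SemiAb.SemiAbelian C] [SemiAb.Arithmetical C] :
    SemiAb.WNH C ∧
      ∀ (X : C) (K : Subobject X), SemiAb.IsNormal K → SemiAb.IsHuqCommutator K K K := by
  refine ⟨fun X K hK => ?_, fun X K hK => SemiAb.isHuqCommutator_self hK⟩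
  rwa [SemiAb.higginsCommutator_self]
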